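/- **Corollary 4.4.** Let $n\ge 0$ be an integer and let $\Gamma$ be an Artin algebra, that is, a ring which is a finitely generated module over a commutative artinian ring $R$ via an $R$-algebra structure. Modules are left modules, $\Gamma\text{-mod}$ denotes the category of finitely generated $\Gamma$-modules, $\mathrm{pd}$ denotes projective dimension, and $\mathrm{soc}\,N$ is the sum of the simple submodules of $N$. The global dimension $\mathrm{gldim}\,\Gamma$ is the supremum of $\mathrm{pd}\,N$ over all $N\in\Gamma\text{-mod}$. The dominant dimension $\mathrm{domdim}\,\Gamma$ is the supremum in $\mathbb N\cup\{\infty\}$ of all $d$ such that, in a minimal injective coresolution $0\to\Gamma\to I_0\to I_1\to\cdots$ of the left module $\Gamma$, the module $I_j$ is projective for all $0\le j<d$. The algebra $\Gamma$ is called an *$n$-Auslander algebra* if $\mathrm{gldim}\,\Gamma\le n+1\le\mathrm{domdim}\,\Gamma$. Let $\mathrm P^{\le n}(\Gamma)$ be the full subcategory of those $N\in\Gamma\text{-mod}$ with $\mathrm{pd}\,N\le n$, and let $\mathrm{sub}\,\Gamma$ be the full subcategory of those $N\in\Gamma\text{-mod}$ that embed into $\Gamma^k$ for some $k\in\mathbb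 N$. Then $\Gamma$ is an $n$-Auslander algebra if and only if $$\mathrm P^{\le n}(\Gamma)=\{N\in\Gamma\text{-mod}\mid \mathrm{pd}(\mathrm{soc}\,N)\le n\}=\mathrm{sub}\,\Gamma .$$ -/

import Mathlib

open CategoryTheory

universe u

namespace ArtinAlg

/-- The socle of a module: the sum of its simple submodules. -/
def socle (Γ : Type u) [Ring Γ] (N : Type u) [AddCommGroup N] [Module Γ N] : Submodule Γ N :=
  sSup {S : Submodule Γ N | IsSimpleModule Γ S}

/-- A submodule is essential if it meets every nonzero submodule nontrivially. -/
def IsEssential {Γ : Type u} [Ring Γ] {N : Type u} [AddCommGroup N] [Module Γ N]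
    (K : Submodule Γ N) : Prop :=
  ∀ L : Submodule Γ N, K ⊓ L = ⊥ → L = ⊥

/-- An injective coresolution `0 → M → I⁰ → I¹ → ⋯` is minimal if the kernel of each
`Iⁱ → Iⁱ⁺¹` is an essential submodule of `Iⁱ`. By exactness this kernel is the image of the
preceding map, so this says that `Iⁱ` is an injective envelope of that image. -/
def IsMinimal {Γ : Type u} [Ring Γ] {M : ModuleCat.{u} Γ} (I : InjectiveResolution M) : Prop :=
  ∀ i : ℕ, IsEssential (LinearMap.ker (I.cocomplex.d i (i + 1)).hom)

/-- The dominant dimension of `Γ`: the supremum (possibly `∞`) of all `d` such that the terms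
`I⁰, …, I^{d-1}` of a minimal injective coresolution of the left regular module are projective. -/
noncomputable def domdim (Γ : Type u) [Ring Γ] : ℕ∞ :=
  sSup {d : ℕ∞ | ∃ I : InjectiveResolution (ModuleCat.of Γ Γ), IsMinimal I ∧
    ∀ j : ℕ, (j : ℕ∞) < d → Module.Projective Γ (I.cocomplex.X j)}

/-- The projective dimension of a module; it is `⊥` for the zero module. -/
noncomputable def pd (Γ : Type u) [Ring Γ] (N : Type u) [AddCommGroup N] [Module Γ N] :
    WithBot ℕ∞ :=
  projectiveDimension (ModuleCat.of Γ N)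

/-- The (left) global dimension of an Artin algebra: the supremum of the projective dimensions of
the finitely generated left modules. -/
noncomputable def gldim (Γ : Type u) [Ring Γ] : WithBot ℕ∞ :=
  ⨆ N : FGModuleCat.{u} Γ, pd Γ N

/-- `Γ` is an `n`-Auslander algebra: `gldim Γ ≤ n + 1 ≤ domdim Γ`. -/
def IsAuslander (n : ℕ) (Γ : Type u) [Ring Γ] : Prop :=
  gldim Γ ≤ ((n + 1 : ℕ) : WithBot ℕ∞) ∧ ((n + 1 : ℕ) : ℕ∞) ≤ domdim Γ

/-- The finitely generated modules of projective dimension at most `n`. -/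
def projDimLE (n : ℕ) (Γ : Type u) [Ring Γ] : ObjectProperty (FGModuleCat.{u} Γ) :=
  fun N => pd Γ N ≤ (n : WithBot ℕ∞)

/-- The finitely generated modules whose socle has projective dimension at most `n`. -/
def socleProjDimLE (n : ℕ) (Γ : Type u) [Ring Γ] : ObjectProperty (FGModuleCat.{u} Γ) :=
  fun N => pd Γ (socle Γ N) ≤ (n : WithBot ℕ∞)

/-- The finitely generated modules cogenerated by `Γ`, that is, embeddable in some `Γᵏ`. -/
def subReg (Γ : Type u) [Ring Γ] : ObjectProperty (FGModuleCat.{u} Γ) :=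
  fun N => ∃ (k : ℕ) (f : N →ₗ[Γ] (Fin k → Γ)), Function.Injective f

end ArtinAlg

/-!
Over an artinian ring, `gldim Γ ≤ n + 1` says that the modules in `sub Γ`, being the first syzygies,
have projective dimension at most `n`. The condition `n + 1 ≤ domdim Γ` says that `P^{≤n}(Γ)` is
contained in `sub Γ` and that a module belongs to `sub Γ` as soon as its socle does. When
`P^{≤n}(Γ) = sub Γ`, the last condition concerns exactly the modules `N` with `pd (soc N) ≤ n`.

If `I⁰, …, Iⁿ` are projective, then a simple module `S` with `Hom(S, Γ) = 0` has no nonzero maps to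
them, so `Extʲ(S, Γ) = 0` for `j ≤ n`, and dimension shifting gives `Hom(S, N) = 0` whenever
`pd N ≤ n`. Hence every simple submodule of such an `N` maps nontrivially to `Γ`, and since `Γ` lies
in the projective injective module `I⁰`, these maps can be extended to `N`.

Conversely, let `Zⁱ` be the cosyzygies of `Γ`. If `Zⁱ` is in `sub Γ`, then so is its injective hull
`Iⁱ`, having the same socle; hence `Iⁱ` is projective, `pd Zⁱ⁺¹ ≤ i + 1`, and `Zⁱ⁺¹` is in `sub Γ`
as long as `i + 1 ≤ n`. Here `Iⁱ` is not known in advance to be finitely generated, but its finitely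
generated submodules lie in `sub Γ`, which bounds their lengths in terms of the length of `Zⁱ`.
-/

namespace ArtinAlg

section Cogenerated

open Module

variable {Γ : Type*} [Ring Γ] {M N : Type*} [AddCommGroup M] [Module Γ M] [AddCommGroup N]
  [Module Γ N]

/-- A module is cogenerated by `Γ` if it embeds into some `Γᵏ`; this is the condition defining
`subReg`, stated for modules which need not be finitely generated. -/
def IsCogenerated (Γ : Type*) [Ring Γ] (M : Type*) [AddCommGroup M] [Module Γ M] : Prop :=
  ∃ (k : ℕ) (f : M →ₗ[Γ] (Fin k → Γ)), Function.Injective f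

theorem IsCogenerated.of_injective (hN : IsCogenerated Γ N) (g : M →ₗ[Γ] N)
    (hg : Function.Injective g) : IsCogenerated Γ M :=
  let ⟨k, f, hf⟩ := hN
  ⟨k, f ∘ₗ g, hf.comp hg⟩

theorem IsCogenerated.exists_dual_ne_zero (hM : IsCogenerated Γ M) {x : M} (hx : x ≠ 0) :
    ∃ f : Dual Γ M, f x ≠ 0 := by
  obtain ⟨k, f, hf⟩ := hM
  obtain ⟨i, hi⟩ := Function.ne_iff.mp ((map_ne_zero_iff f hf).mpr hx)
  exact ⟨LinearMap.proj i ∘ₗ f, hi⟩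

theorem isCogenerated_of_exists_dual_ne_zero [IsArtinian Γ M]
    (h : ∀ x : M, x ≠ 0 → ∃ f : Dual Γ M, f x ≠ 0) : IsCogenerated Γ M := by
  obtain ⟨s, hs⟩ := Finset.exists_inf_le fun f : Dual Γ M => LinearMap.ker f
  let p : M →ₗ[Γ] (s → Γ) := LinearMap.pi Subtype.val
  have hp : Function.Injective p := by
    refine (injective_iff_map_eq_zero _).mpr fun x hx => ?_
    by_contra hne
    obtain ⟨f, hf⟩ := h x hne
    exact hf (hs f (Submodule.mem_finsetInf.mpr fun g hg => congrFun hx ⟨g, hg⟩))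
  exact ⟨s.card, LinearMap.funLeft Γ Γ s.equivFin.symm ∘ₗ p,
    (LinearMap.funLeft_injective_of_surjective Γ Γ _ s.equivFin.symm.surjective).comp hp⟩

theorem IsCogenerated.finite [IsNoetherianRing Γ] (h : IsCogenerated Γ M) : Module.Finite Γ M :=
  let ⟨_, f, hf⟩ := h
  Module.Finite.of_injective f hf

end Cogenerated

section Essential

variable {Γ : Type u} [Ring Γ] {M N : Type u} [AddCommGroup M] [Module Γ M] [AddCommGroup N]
  [Module Γ N]

theorem isEssential_comap_subtype_iff {K E : Submodule Γ M} :
    IsEssential (K.comap E.subtype) ↔ ∀ L ≤ E, Disjoint K L → L = ⊥ := by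
  have hmap (L : Submodule Γ E) :
      K.comap E.subtype ⊓ L = ⊥ ↔ Disjoint K (L.map E.subtype) := by
    simp only [← disjoint_iff, Submodule.disjoint_def, Submodule.mem_comap, Submodule.mem_map,
      Subtype.forall, Submodule.subtype_apply, Subtype.exists, exists_and_right, exists_eq_right,
      Submodule.mk_eq_zero, forall_exists_index]
    exact ⟨fun h x hK hE => h x hE hK, fun h x hE hK => h x hK hE⟩
  constructor
  · intro h L hL hKL
    have hL' : (L.comap E.subtype).map E.subtype = L :=
      Submodule.map_comap_eq_self (by simpa using hL)
    rw [← hL'] at hKL ⊢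
    rw [h _ ((hmap _).mpr hKL), Submodule.map_bot]
  · intro h L hL
    refine Submodule.map_injective_of_injective E.subtype_injective ?_
    rw [h _ (Submodule.map_subtype_le E L) ((hmap L).mp hL), Submodule.map_bot]

theorem IsEssential.comap_subtype {K L : Submodule Γ M} (hK : IsEssential K) :
    IsEssential (K.comap L.subtype) :=
  isEssential_comap_subtype_iff.mpr fun L' _ h => hK L' h.eq_bot

theorem IsEssential.injective {K : Submodule Γ M} (hK : IsEssential K) (f : M →ₗ[Γ] N)
    (hf : Function.Injective (f.domRestrict K)) : Function.Injective f :=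
  LinearMap.ker_eq_bot.mp (hK _ (LinearMap.injective_domRestrict_iff.mp hf).eq_bot)

theorem IsEssential.socle_le {K : Submodule Γ M} (hK : IsEssential K) : socle Γ M ≤ K := by
  refine sSup_le fun S (hS : IsSimpleModule Γ S) => ?_
  have hatom := isSimpleModule_iff_isAtom.mp hS
  exact (hatom.not_disjoint_iff_le).mp fun h => hatom.1 (hK S h.symm.eq_bot)

end Essential

section Length

theorem exists_finset_card_add_height_inf_le {α ι : Type*} [SemilatticeInf α] [OrderTop α]
    [WellFoundedLT α] (K : ι → α) :
    ∃ s : Finset ι, s.card + Order.height (s.inf K) ≤ Order.height (⊤ : α) ∧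
      ∀ i, s.inf K ≤ K i := by
  classical
  obtain ⟨s, hs⟩ := exists_minimalFor_of_wellFoundedLT
    (fun s : Finset ι => s.card + Order.height (s.inf K) ≤ Order.height (⊤ : α))
    (fun s => s.inf K) ⟨∅, by simp⟩
  refine ⟨s, hs.prop, fun i => ?_⟩
  by_contra hi
  have hlt : (insert i s).inf K < s.inf K := by
    rw [Finset.inf_insert]
    exact inf_lt_right.mpr hi
  refine hs.not_lt ?_ hlt
  calc ((insert i s).card : ℕ∞) + Order.height ((insert i s).inf K)
      ≤ (s.card + 1 : ℕ) + Order.height ((insert i s).inf K) := by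
        gcongr
        exact Finset.card_insert_le i s
    _ = s.card + (Order.height ((insert i s).inf K) + 1) := by push_cast; ring
    _ ≤ s.card + Order.height (s.inf K) := by
        gcongr
        exact Order.height_add_one_le hlt
    _ ≤ Order.height (⊤ : α) := hs.prop

theorem finite_of_length_le {Γ M : Type*} [Ring Γ] [AddCommGroup M] [Module Γ M] {b : ℕ∞}
    (hb : b ≠ ⊤) (h : ∀ L : Submodule Γ M, L.FG → Module.length Γ L ≤ b) : Module.Finite Γ M := by
  have hfin : ((fun L : Submodule Γ M => Module.length Γ L) '' {L | L.FG}).Finite := by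
    lift b to ℕ using hb
    exact (Set.finite_Iic b |>.image ((↑) : ℕ → ℕ∞)).subset <| by
      rintro _ ⟨L, hL, rfl⟩
      have htop := ne_top_of_le_ne_top (ENat.natCast_ne_top b) (h L hL)
      lift Module.length Γ L to ℕ using htop with m hm
      exact ⟨m, Nat.cast_le.mp (hm ▸ h L hL), rfl⟩
  obtain ⟨L, hL⟩ : ∃ L : Submodule Γ M,
      MaximalFor (·.FG) (fun L : Submodule Γ M => Module.length Γ L) L :=
    Set.Finite.exists_maximalFor' _ _ hfin ⟨⊥, Submodule.fg_bot⟩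
  have htop : L = ⊤ := by
    refine Submodule.eq_top_iff'.mpr fun x => ?_
    by_contra hx
    have hfg : (L ⊔ Γ ∙ x).FG := hL.prop.sup (Submodule.fg_span_singleton x)
    refine hL.not_prop_of_gt ?_ hfg
    simp only [Module.length_submodule]
    refine Order.height_strictMono (by simpa using hx) ?_
    rw [← Module.length_submodule]
    exact (h L hL.prop).trans_lt hb.lt_top
  exact ⟨htop ▸ hL.prop⟩

variable {Γ : Type u} [Ring Γ] {M : Type u} [AddCommGroup M] [Module Γ M]

theorem IsCogenerated.length_le {K : Submodule Γ M} [IsArtinian Γ K] (hK : IsEssential K)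
    (hM : IsCogenerated Γ M) : Module.length Γ M ≤ Module.length Γ K * Module.length Γ Γ := by
  obtain ⟨k, f, hf⟩ := hM
  obtain ⟨s, hs, hs_le⟩ := exists_finset_card_add_height_inf_le fun i : Fin k =>
    LinearMap.ker (LinearMap.proj i ∘ₗ f.domRestrict K)
  -- At most `length K` of the `k` coordinates are needed to separate `K`, hence to separate `M`.
  let p : M →ₗ[Γ] (s → Γ) := LinearMap.funLeft Γ Γ (Subtype.val : s → Fin k) ∘ₗ f
  have hp : Function.Injective p := hK.injective p <|
    (injective_iff_map_eq_zero _).mpr fun x hx => Subtype.ext <| hf <| by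
      rw [Submodule.coe_zero, map_zero]
      ext i
      exact hs_le i (Submodule.mem_finsetInf.mpr fun j hj => congrFun hx ⟨j, hj⟩)
  calc Module.length Γ M ≤ Module.length Γ (s → Γ) := Module.length_le_of_injective p hp
    _ = s.card * Module.length Γ Γ := by simp
    _ ≤ Module.length Γ K * Module.length Γ Γ := by
        gcongr
        rw [Module.length_eq_height]
        exact le_self_add.trans hs

/-- The finitely generated modules whose socle is cogenerated by `Γ`. -/
def socleSubReg (Γ : Type u) [Ring Γ] : ObjectProperty (FGModuleCat.{u} Γ) :=
  fun N => IsCogenerated Γ (socle Γ N)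

theorem subReg_le_socleSubReg : subReg Γ ≤ socleSubReg Γ := fun N hN =>
  IsCogenerated.of_injective hN (socle Γ N).subtype (Submodule.subtype_injective _)

theorem isCogenerated_of_isEssential [IsArtinianRing Γ] (hsoc : socleSubReg Γ ≤ subReg Γ)
    {K : Submodule Γ M} (hK : IsEssential K) (hKc : IsCogenerated Γ K) : IsCogenerated Γ M := by
  have := hKc.finite
  let j (L : Submodule Γ M) : K.comap L.subtype →ₗ[Γ] K := L.subtype.restrict fun _ hx => hx
  have hj (L : Submodule Γ M) : Function.Injective (j L) :=
    (LinearMap.injective_restrict_iff _).mpr (by simp)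
  have hfg (L : Submodule Γ M) (hL : L.FG) : IsCogenerated Γ L := by
    have := Module.Finite.iff_fg.mpr hL
    have hle : socle Γ L ≤ K.comap L.subtype := hK.comap_subtype.socle_le
    exact hsoc (FGModuleCat.of Γ L) <| hKc.of_injective (j L ∘ₗ Submodule.inclusion hle)
      ((hj L).comp (Submodule.inclusion_injective hle))
  have hlen (L : Submodule Γ M) (hL : L.FG) :
      Module.length Γ L ≤ Module.length Γ K * Module.length Γ Γ := by
    have := isArtinian_of_injective (j L) (hj L)
    refine ((hfg L hL).length_le hK.comap_subtype).trans ?_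
    gcongr
    exact Module.length_le_of_injective (j L) (hj L)
  have : Module.Finite Γ M :=
    finite_of_length_le (WithTop.mul_ne_top Module.length_ne_top Module.length_ne_top) hlen
  exact (hfg ⊤ Module.Finite.fg_top).of_injective _ Submodule.topEquiv.symm.injective

end Length

section Hull

theorem exists_le_maximal_disjoint {α : Type*} [CompleteLattice α] [IsCompactlyGenerated α]
    {a b : α} (h : Disjoint a b) : ∃ c, a ≤ c ∧ Maximal (Disjoint · b) c :=
  zorn_le_nonempty₀ {c | Disjoint c b} (fun s hs hchain _ _ =>
    ⟨sSup s, (DirectedOn.disjoint_sSup_left hchain.directedOn).mpr hs, fun _ => le_sSup⟩) a h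

theorem exists_maximal_disjoint_pair {α : Type*} [CompleteLattice α] [IsModularLattice α]
    [IsCompactlyGenerated α] (k : α) :
    ∃ e c : α, Maximal (Disjoint · c) e ∧ Maximal (Disjoint · e) c ∧ k ≤ e ∧
      ∀ l ≤ e, Disjoint k l → l = ⊥ := by
  obtain ⟨c, -, hc⟩ := exists_le_maximal_disjoint (disjoint_bot_left : Disjoint ⊥ k)
  obtain ⟨e, hke, he⟩ := exists_le_maximal_disjoint hc.prop.symm
  refine ⟨e, c, he, ⟨he.prop.symm, fun d hd => hc.2 (hd.mono_right hke)⟩, hke, fun l hl hkl => ?_⟩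
  have hcl : Disjoint (c ⊔ l) k :=
    Disjoint.disjoint_sup_left_of_disjoint_sup_right hkl.symm
      (he.prop.symm.mono_right (sup_le hl hke))
  have hlc : l ≤ c := le_sup_right.trans (hc.2 hcl le_sup_left)
  exact disjoint_self.mp (he.prop.mono hl hlc)

variable {Γ : Type u} [Ring Γ] {M : Type u} [AddCommGroup M] [Module Γ M]

theorem isCompl_of_maximal_disjoint [Module.Injective Γ M] {E C : Submodule Γ M}
    (hE : Maximal (Disjoint · C) E) (hC : Maximal (Disjoint · E) C) : IsCompl E C := by
  have hinj : Function.Injective (C.mkQ ∘ₗ E.subtype) := by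
    rw [← LinearMap.ker_eq_bot, LinearMap.ker_comp, Submodule.ker_mkQ,
      ← Submodule.disjoint_iff_comap_eq_bot]
    exact hE.prop
  obtain ⟨g, hg⟩ := Module.Injective.extension_property _ _ _ _ _ hinj E.subtype
  -- Maximality of `C` and `E` makes `φ` a projection onto `E` with kernel `C`.
  let φ : M →ₗ[Γ] M := g ∘ₗ C.mkQ
  have hφE : ∀ x ∈ E, φ x = x := fun x hx => LinearMap.congr_fun hg ⟨x, hx⟩
  have hφC : C ≤ LinearMap.ker φ := fun x hx => by
    simp [φ, (Submodule.Quotient.mk_eq_zero C).mpr hx]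
  have hcomap : C.comap φ ≤ C := hC.2 (Submodule.disjoint_def.mpr fun x hx hxE =>
    Submodule.disjoint_def.mp hC.prop x (by simpa [hφE x hxE] using hx) hxE) fun x hx => by
      simp [LinearMap.mem_ker.mp (hφC hx)]
  have hrange : LinearMap.range φ ≤ E := hE.2 (Submodule.disjoint_def.mpr (by
    rintro _ ⟨x, rfl⟩ hx
    exact hφC (hcomap hx))) fun x hx => ⟨x, hφE x hx⟩
  refine ⟨hE.prop, codisjoint_iff.mpr (Submodule.eq_top_iff'.mpr fun x => ?_)⟩
  have hφx : φ x ∈ E := hrange ⟨x, rfl⟩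
  refine Submodule.mem_sup.mpr ⟨φ x, hφx, x - φ x, hcomap ?_, by simp⟩
  simp [hφE _ hφx]

theorem injective_of_isCompl [Module.Injective Γ M] {E C : Submodule Γ M} (h : IsCompl E C) :
    Module.Injective Γ E where
  out X Y _ _ _ _ f hf g := by
    obtain ⟨k, hk⟩ := Module.Injective.out f hf (E.subtype ∘ₗ g)
    exact ⟨E.projectionOnto C h ∘ₗ k, fun x => by simp [hk]⟩

variable (Γ M) in
theorem exists_injective_hull : ∃ (E : ModuleCat.{u} Γ) (f : M →ₗ[Γ] E),
    Function.Injective f ∧ Module.Injective Γ E ∧ IsEssential (LinearMap.range f) := by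
  let J := Injective.under (ModuleCat.of Γ M)
  let ι : M →ₗ[Γ] J := (Injective.ι (ModuleCat.of Γ M)).hom
  have hι : Function.Injective ι := (ModuleCat.mono_iff_injective _).mp inferInstance
  have : Module.Injective Γ J := Module.injective_module_of_injective_object Γ J
    (inj := inferInstanceAs (Injective (Injective.under _)))
  obtain ⟨E, C, hE, hC, hle, hess⟩ := exists_maximal_disjoint_pair (LinearMap.range ι)
  have hmem : ∀ x, ι x ∈ E := fun x => hle ⟨x, rfl⟩
  refine ⟨ModuleCat.of Γ E, ι.codRestrict E hmem, hι.codRestrict hmem,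
    injective_of_isCompl (isCompl_of_maximal_disjoint hE hC), ?_⟩
  rw [LinearMap.range_codRestrict]
  exact isEssential_comap_subtype_iff.mpr hess

end Hull

section Splice

open Limits

variable {C : Type*} [Category* C] [Abelian C]

/-- An exact sequence `0 ⟶ M ⟶ K⁰ ⟶ K¹ ⟶ ⋯` with injective terms `Kⁱ`, as an injective
resolution. -/
noncomputable def injectiveResolutionOfExact {M : C} (K : CochainComplex C ℕ)
    (hK : ∀ i, Injective (K.X i)) (f : M ⟶ K.X 0) (w : f ≫ K.d 0 1 = 0) (hf : Mono f)
    (h₀ : (ShortComplex.mk f (K.d 0 1) w).Exact) (h : ∀ i, K.ExactAt (i + 1)) :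
    InjectiveResolution M where
  cocomplex := K
  injective := hK
  ι := (CochainComplex.fromSingle₀Equiv _ _).symm ⟨f, w⟩
  quasiIso := ⟨fun n => by
    cases n
    · rw [CochainComplex.quasiIsoAt₀_iff, ShortComplex.quasiIso_iff_of_zeros]
      · refine (ShortComplex.exact_and_mono_f_iff_of_iso ?_).2 ⟨h₀, hf⟩
        exact ShortComplex.isoMk (Iso.refl _) (Iso.refl _) (Iso.refl _)
          (by
            simp only [Iso.refl_hom, HomologicalComplex.shortComplexFunctor'_map_τ₂,
              CochainComplex.fromSingle₀Equiv_symm_apply_f_zero]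
            exact (Category.id_comp f).trans (Category.comp_id f).symm)
          ((Category.id_comp (K.d 0 1)).trans (Category.comp_id (K.d 0 1)).symm)
      · rfl
      · rfl
      · exact K.shape 0 0 (by simp)
    · rw [quasiIsoAt_iff_exactAt]
      · exact h _
      · exact CochainComplex.exactAt_succ_single_obj _ _⟩

variable {Z J : ℕ → C} {f : ∀ i, Z i ⟶ J i}
  {g : ∀ i, J i ⟶ Z (i + 1)} (w : ∀ i, f i ≫ g i = 0)

include w in
theorem comp_splice_d_eq_zero (i : ℕ) : f i ≫ g i ≫ f (i + 1) = 0 := by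
  rw [reassoc_of% (w i), zero_comp]

include w in
theorem splice_d_comp_splice_d (i : ℕ) : (g i ≫ f (i + 1)) ≫ g (i + 1) ≫ f (i + 2) = 0 := by
  rw [Category.assoc, comp_splice_d_eq_zero w, comp_zero]

/-- The Yoneda splice of the short complexes `Z i ⟶ J i ⟶ Z (i + 1)`: the complex
`J 0 ⟶ J 1 ⟶ ⋯` whose differentials are the composites `J i ⟶ Z (i + 1) ⟶ J (i + 1)`. -/
noncomputable def splice : CochainComplex C ℕ :=
  CochainComplex.of J (fun i => g i ≫ f (i + 1)) (splice_d_comp_splice_d w)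

theorem splice_d (i : ℕ) : (splice w).d i (i + 1) = g i ≫ f (i + 1) :=
  CochainComplex.of_d J (fun i => g i ≫ f (i + 1)) i

variable {w} (h : ∀ i, (ShortComplex.mk (f i) (g i) (w i)).ShortExact)
include h

theorem exact_comp_splice_d (i : ℕ) :
    (ShortComplex.mk (f i) (g i ≫ f (i + 1)) (comp_splice_d_eq_zero w i)).Exact := by
  let φ : ShortComplex.mk _ _ (w i) ⟶ ShortComplex.mk _ _ (comp_splice_d_eq_zero w i) :=
    { τ₁ := 𝟙 _, τ₂ := 𝟙 _, τ₃ := f (i + 1) }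
  have : Mono φ.τ₃ := (h (i + 1)).mono_f
  exact (ShortComplex.exact_iff_of_epi_of_isIso_of_mono φ).mp (h i).exact

theorem exact_splice_d_comp_splice_d (i : ℕ) :
    (ShortComplex.mk _ _ (splice_d_comp_splice_d w i)).Exact := by
  let φ : ShortComplex.mk _ _ (splice_d_comp_splice_d w i) ⟶
      ShortComplex.mk _ _ (comp_splice_d_eq_zero w (i + 1)) :=
    { τ₁ := g i, τ₂ := 𝟙 _, τ₃ := 𝟙 _ }
  have : Epi φ.τ₁ := (h i).epi_g
  exact (ShortComplex.exact_iff_of_epi_of_isIso_of_mono φ).mpr (exact_comp_splice_d h (i + 1))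

theorem splice_exactAt_succ (i : ℕ) : (splice w).ExactAt (i + 1) := by
  rw [HomologicalComplex.exactAt_iff' _ i (i + 1) (i + 1 + 1) (by simp) (by simp)]
  simp only [HomologicalComplex.sc', HomologicalComplex.shortComplexFunctor', splice_d]
  exact exact_splice_d_comp_splice_d h i

/-- The injective resolution of `Z 0` spliced from short exact sequences
`0 ⟶ Z i ⟶ J i ⟶ Z (i + 1) ⟶ 0` with injective middle terms. -/
noncomputable def spliceResolution [∀ i, Injective (J i)] : InjectiveResolution (Z 0) :=
  injectiveResolutionOfExact (splice w) (fun i => inferInstanceAs (Injective (J i))) (f 0)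
    (by rw [splice_d]; exact comp_splice_d_eq_zero w 0) (h 0).mono_f
    (by simp only [splice_d]; exact exact_comp_splice_d h 0) (splice_exactAt_succ h)

theorem spliceResolution_d [∀ i, Injective (J i)] (i : ℕ) :
    (spliceResolution h).cocomplex.d i (i + 1) = g i ≫ f (i + 1) :=
  splice_d w i

end Splice

section MinimalResolution

open Limits

variable {Γ : Type u} [Ring Γ] (M : ModuleCat.{u} Γ)

/-- An injective hull of a module. -/
noncomputable def hull : ModuleCat.{u} Γ :=
  (exists_injective_hull Γ M).choose

/-- The embedding of a module into its injective hull. -/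
noncomputable def toHull : M ⟶ hull M :=
  ModuleCat.ofHom (exists_injective_hull Γ M).choose_spec.choose

theorem toHull_injective : Function.Injective (toHull M).hom :=
  (exists_injective_hull Γ M).choose_spec.choose_spec.1

instance mono_toHull : Mono (toHull M) :=
  (ModuleCat.mono_iff_injective _).mpr (toHull_injective M)

instance module_injective_hull : Module.Injective Γ (hull M) :=
  (exists_injective_hull Γ M).choose_spec.choose_spec.2.1

instance injective_hull : Injective (hull M) :=
  Module.injective_object_of_injective_module Γ (hull M)

theorem isEssential_range_toHull : IsEssential (LinearMap.range (toHull M).hom) :=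
  (exists_injective_hull Γ M).choose_spec.choose_spec.2.2

/-- The iterated cosyzygies of a module: `cosyzygy M (i + 1)` is the cokernel of the injective
hull of `cosyzygy M i`. -/
noncomputable def cosyzygy : ℕ → ModuleCat.{u} Γ
  | 0 => M
  | i + 1 => cokernel (toHull (cosyzygy i))

theorem shortExact_cosyzygy (i : ℕ) :
    (ShortComplex.mk (toHull (cosyzygy M i)) (cokernel.π (toHull (cosyzygy M i)))
      (cokernel.condition _) : ShortComplex (ModuleCat Γ)).ShortExact :=
  .mk' (ShortComplex.exact_cokernel _) (mono_toHull _) (inferInstanceAs (Epi (cokernel.π _)))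

/-- A minimal injective coresolution, spliced from injective hulls of the cosyzygies. -/
noncomputable def minimalResolution : InjectiveResolution M :=
  spliceResolution (Z := cosyzygy M) (shortExact_cosyzygy M)

theorem isMinimal_minimalResolution : IsMinimal (minimalResolution M) := fun i => by
  have hker := (exact_comp_splice_d (Z := cosyzygy M) (shortExact_cosyzygy M)
    i).moduleCat_range_eq_ker
  have hd : (minimalResolution M).cocomplex.d i (i + 1) =
      cokernel.π (toHull (cosyzygy M i)) ≫ toHull (cosyzygy M (i + 1)) :=
    spliceResolution_d (Z := cosyzygy M) (shortExact_cosyzygy M) i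
  exact (congrArg (fun d => IsEssential (LinearMap.ker (ModuleCat.Hom.hom d))) hd).mpr
    (hker ▸ isEssential_range_toHull (cosyzygy M i))

end MinimalResolution

section Ext

open Abelian

universe w

variable {C : Type*} [Category* C] [Abelian C] [HasExt.{w} C] {X Y : C} {j : ℕ}

theorem subsingleton_ext_of_hom_eq_zero (I : InjectiveResolution Y)
    (h : ∀ f : X ⟶ I.cocomplex.X j, f = 0) : Subsingleton (Ext X Y j) :=
  subsingleton_of_forall_eq 0 fun e => by
    obtain ⟨f, hf, rfl⟩ := I.extMk_surjective e (j + 1) rfl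
    obtain rfl := h f
    exact I.extMk_zero _ rfl

theorem subsingleton_ext_of_sum_comp_eq_id {ι : Type*} [Fintype ι] {A : C}
    (p : ι → (Y ⟶ A)) (q : ι → (A ⟶ Y)) (h : ∑ i, p i ≫ q i = 𝟙 Y)
    [Subsingleton (Ext X A j)] : Subsingleton (Ext X Y j) :=
  subsingleton_of_forall_eq 0 fun e => by
    rw [← Ext.comp_mk₀_id e, ← h, Ext.mk₀_sum, Ext.comp_sum]
    refine Finset.sum_eq_zero fun i _ => ?_
    rw [← Ext.mk₀_comp_mk₀, ← Ext.comp_assoc_of_third_deg_zero,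
      Subsingleton.elim (e.comp (Ext.mk₀ (p i)) _) 0, Ext.zero_comp]

end Ext

section ProjectiveDimension

open Abelian

variable {Γ : Type u} [Ring Γ]

instance projective_of_pi (ι : Type) [Finite ι] : Projective (ModuleCat.of Γ (ι → Γ)) :=
  (IsProjective.iff_projective _).mp inferInstance

theorem subsingleton_ext_of_projective {X : ModuleCat.{u} Γ} {j : ℕ}
    [Subsingleton (Ext X (ModuleCat.of Γ Γ) j)] (P : Type u) [AddCommGroup P] [Module Γ P]
    [Module.Finite Γ P] [Module.Projective Γ P] : Subsingleton (Ext X (ModuleCat.of Γ P) j) := by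
  obtain ⟨m, f, g, -, -, hfg⟩ := Module.Finite.exists_comp_eq_id_of_projective Γ P
  refine subsingleton_ext_of_sum_comp_eq_id (A := ModuleCat.of Γ Γ)
    (fun i => ModuleCat.ofHom (LinearMap.proj i ∘ₗ g))
    (fun i => ModuleCat.ofHom (f ∘ₗ LinearMap.single Γ (fun _ => Γ) i)) ?_
  refine ModuleCat.hom_ext (LinearMap.ext fun x => ?_)
  simp [ModuleCat.hom_sum, ← map_sum, Finset.univ_sum_single, ← LinearMap.comp_apply, hfg]

theorem subsingleton_ext_of_hasProjectiveDimensionLT [IsNoetherianRing Γ] {X : ModuleCat.{u} Γ}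
    {k j : ℕ} (hX : ∀ i ≤ k, Subsingleton (Ext X (ModuleCat.of Γ Γ) (j + i))) (N : Type u)
    [AddCommGroup N] [Module Γ N] [Module.Finite Γ N]
    (hN : HasProjectiveDimensionLT (ModuleCat.of Γ N) (k + 1)) :
    Subsingleton (Ext X (ModuleCat.of Γ N) j) := by
  have := hX 0 (Nat.zero_le k)
  induction k generalizing j N with
  | zero =>
    have := (IsProjective.iff_projective (R := Γ) N).mpr
      (projective_iff_hasProjectiveDimensionLT_one.mpr hN)
    exact subsingleton_ext_of_projective N
  | succ k ih =>
    obtain ⟨m, f, hf⟩ := Module.Finite.exists_fin' Γ N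
    have hexact := LinearMap.shortExact_shortComplexKer hf
    have hker : Subsingleton (Ext X (ModuleCat.of Γ (LinearMap.ker f)) (j + 1)) :=
      ih (fun i hi => by simpa only [add_right_comm, add_assoc] using hX (i + 1) (by omega)) _
        ((hexact.hasProjectiveDimensionLT_X₃_iff k (projective_of_pi _)).mp hN)
        (hX 1 (by omega))
    have hfree := subsingleton_ext_of_projective (X := X) (j := j) (Fin m → Γ)
    refine subsingleton_of_forall_eq 0 fun e => ?_
    obtain ⟨e', rfl⟩ := Ext.covariant_sequence_exact₃ X hexact e rfl (hker.elim _ _)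
    rw [hfree.elim e' 0, Ext.zero_comp]

theorem pd_le_iff {N : Type u} [AddCommGroup N] [Module Γ N] {n : ℕ} :
    pd Γ N ≤ (n : WithBot ℕ∞) ↔ HasProjectiveDimensionLT (ModuleCat.of Γ N) (n + 1) :=
  projectiveDimension_le_iff _ _

theorem gldim_le_succ_iff [IsNoetherianRing Γ] {n : ℕ} :
    gldim Γ ≤ ((n + 1 : ℕ) : WithBot ℕ∞) ↔ subReg Γ ≤ projDimLE n Γ := by
  rw [gldim, iSup_le_iff]
  constructor
  · rintro h N ⟨k, f, hf⟩
    have hexact : (ModuleCat.shortComplexOfCompEqZero f (LinearMap.range f).mkQ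
        (LinearMap.range_mkQ_comp f)).ShortExact :=
      ModuleCat.shortComplex_shortExact _ (LinearMap.exact_map_mkQ_range f) hf
        (Submodule.mkQ_surjective _)
    have hfree : HasProjectiveDimensionLT (ModuleCat.of Γ (Fin k → Γ)) (n + 1) :=
      hasProjectiveDimensionLT_of_ge _ 1 (n + 1) (by omega)
    exact pd_le_iff.mpr <| hexact.hasProjectiveDimensionLT_X₁ (n + 1) hfree <|
      pd_le_iff.mp (h (FGModuleCat.of Γ ((Fin k → Γ) ⧸ LinearMap.range f)))
  · intro h N
    obtain ⟨m, f, hf⟩ := Module.Finite.exists_fin' Γ N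
    have hker : pd Γ (LinearMap.ker f) ≤ n :=
      h (FGModuleCat.of Γ (LinearMap.ker f)) ⟨m, _, (LinearMap.ker f).subtype_injective⟩
    have hexact := LinearMap.shortExact_shortComplexKer hf
    exact pd_le_iff.mpr <| (hexact.hasProjectiveDimensionLT_X₃_iff n (projective_of_pi _)).mpr
      (pd_le_iff.mp hker)

end ProjectiveDimension

section DominantDimension

open Abelian Module

variable {Γ : Type u} [Ring Γ] {M : Type u} [AddCommGroup M] [Module Γ M]

theorem succ_le_domdim_iff_exists {n : ℕ} :
    ((n + 1 : ℕ) : ℕ∞) ≤ domdim Γ ↔ ∃ I : InjectiveResolution (ModuleCat.of Γ Γ), IsMinimal I ∧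
      ∀ j ≤ n, Module.Projective Γ (I.cocomplex.X j) := by
  constructor
  · intro h
    have hlt : (n : ℕ∞) < domdim Γ := lt_of_lt_of_le (by exact_mod_cast n.lt_succ_self) h
    obtain ⟨d, ⟨I, hI, hd⟩, hnd⟩ := lt_sSup_iff.mp hlt
    exact ⟨I, hI, fun j hj => hd j (lt_of_le_of_lt (by exact_mod_cast hj) hnd)⟩
  · rintro ⟨I, hI, h⟩
    exact le_sSup ⟨I, hI, fun j hj => h j (Nat.lt_succ_iff.mp (by exact_mod_cast hj))⟩

/-- `Γ` embeds into a projective injective left module; for Artin algebras this is the left QF-3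
condition of Thrall. -/
def IsQF3 (Γ : Type u) [Ring Γ] : Prop :=
  ∃ (E : ModuleCat.{u} Γ) (ι : Γ →ₗ[Γ] E),
    Function.Injective ι ∧ Module.Injective Γ E ∧ Module.Projective Γ E

theorem isQF3_of_projective_zero (I : InjectiveResolution (ModuleCat.of Γ Γ))
    (h : Module.Projective Γ (I.cocomplex.X 0)) : IsQF3 Γ :=
  let ι : ModuleCat.of Γ Γ ⟶ I.cocomplex.X 0 := I.ι.f 0
  ⟨I.cocomplex.X 0, ι.hom, (ModuleCat.mono_iff_injective ι).mp (inferInstanceAs (Mono (I.ι.f 0))),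
    Module.injective_module_of_injective_object Γ _ (inj := I.injective 0), h⟩

theorem IsQF3.exists_dual_ne_zero (hΓ : IsQF3 Γ) {K : Submodule Γ M} {f : Dual Γ K} {y : K}
    (hy : f y ≠ 0) : ∃ g : Dual Γ M, g y ≠ 0 := by
  obtain ⟨E, ι, hι, _, _⟩ := hΓ
  obtain ⟨h, hh⟩ := Module.Injective.extension_property _ _ _ _ K.subtype K.subtype_injective
    (ι ∘ₗ f)
  have hhy : h y = ι (f y) := LinearMap.congr_fun hh y
  obtain ⟨p, hp⟩ := Module.Projective.exists_dual_ne_zero Γ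
    (hhy ▸ (map_ne_zero_iff ι hι).mpr hy : h y ≠ 0)
  exact ⟨p ∘ₗ h, hp⟩

theorem IsQF3.isCogenerated_of_forall_simple (hΓ : IsQF3 Γ) [IsArtinian Γ M]
    (h : ∀ S : Submodule Γ M, IsSimpleModule Γ S → ∃ f : Dual Γ S, f ≠ 0) :
    IsCogenerated Γ M := by
  refine isCogenerated_of_exists_dual_ne_zero fun x hx => ?_
  obtain ⟨S, hS, hSx⟩ := (eq_bot_or_exists_atom_le (Γ ∙ x)).resolve_left (by simpa using hx)
  obtain ⟨f, hf⟩ := h S (isSimpleModule_iff_isAtom.mpr hS)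
  obtain ⟨y, hy⟩ := DFunLike.ne_iff.mp hf
  obtain ⟨g, hg⟩ := hΓ.exists_dual_ne_zero hy
  obtain ⟨a, ha⟩ := Submodule.mem_span_singleton.mp (hSx y.2)
  refine ⟨g, fun hgx => hg ?_⟩
  rw [← ha, map_smul, hgx, smul_zero]

theorem IsQF3.socleSubReg_le_subReg [IsArtinianRing Γ] (hΓ : IsQF3 Γ) :
    socleSubReg Γ ≤ subReg Γ := fun N hN =>
  hΓ.isCogenerated_of_forall_simple fun S hS => by
    have hle : S ≤ socle Γ N := le_sSup hS
    have := IsSimpleModule.nontrivial Γ S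
    obtain ⟨x, hx⟩ := exists_ne (0 : S)
    have hSc : IsCogenerated Γ S := hN.of_injective _ (Submodule.inclusion_injective hle)
    obtain ⟨f, hf⟩ := hSc.exists_dual_ne_zero hx
    exact ⟨f, fun h => hf (LinearMap.congr_fun h x)⟩

theorem projDimLE_le_subReg [IsArtinianRing Γ] {n : ℕ}
    (I : InjectiveResolution (ModuleCat.of Γ Γ))
    (hI : ∀ j ≤ n, Module.Projective Γ (I.cocomplex.X j)) : projDimLE n Γ ≤ subReg Γ := by
  intro N hN
  have hΓ : IsQF3 Γ := isQF3_of_projective_zero I (hI 0 (Nat.zero_le n))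
  refine hΓ.isCogenerated_of_forall_simple fun S hS => ?_
  by_contra! hdual
  have hhom (j : ℕ) (hj : j ≤ n) (f : ModuleCat.of Γ S ⟶ I.cocomplex.X j) : f = 0 := by
    have := hI j hj
    ext x
    by_contra hx
    obtain ⟨p, hp⟩ := Module.Projective.exists_dual_ne_zero Γ hx
    exact hp (LinearMap.congr_fun (hdual (p ∘ₗ f.hom)) x)
  have hext : Subsingleton (Ext (ModuleCat.of Γ S) (ModuleCat.of Γ N) 0) :=
    subsingleton_ext_of_hasProjectiveDimensionLT (k := n)
      (fun j hj => subsingleton_ext_of_hom_eq_zero I (hhom _ (by omega))) N (pd_le_iff.mp hN)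
  have hincl : ModuleCat.ofHom S.subtype = 0 :=
    (Ext.mk₀_bijective _ _).injective (hext.elim _ _)
  refine (isSimpleModule_iff_isAtom.mp hS).ne_bot ?_
  rw [← S.range_subtype, LinearMap.range_eq_bot]
  exact congrArg ModuleCat.Hom.hom hincl

theorem IsCogenerated.projective [Module.Injective Γ M] (h : IsCogenerated Γ M) :
    Module.Projective Γ M := by
  obtain ⟨k, f, hf⟩ := h
  obtain ⟨r, hr⟩ := Module.Injective.extension_property _ _ _ _ f hf LinearMap.id
  exact Module.Projective.of_split f r hr

end DominantDimension

section Auslander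

variable {Γ : Type u} [Ring Γ] [IsArtinianRing Γ] {n : ℕ}

theorem isCogenerated_hull (hsoc : socleSubReg Γ ≤ subReg Γ) {N : ModuleCat.{u} Γ}
    (hN : IsCogenerated Γ N) : IsCogenerated Γ (hull N) :=
  isCogenerated_of_isEssential hsoc (isEssential_range_toHull N) <|
    hN.of_injective _ (LinearEquiv.ofInjective _ (toHull_injective N)).symm.injective

theorem finite_and_hasProjectiveDimensionLT_cosyzygy_succ (hsoc : socleSubReg Γ ≤ subReg Γ)
    {M : ModuleCat.{u} Γ} {i k : ℕ} (hM : IsCogenerated Γ (cosyzygy M i))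
    (hpd : HasProjectiveDimensionLT (cosyzygy M i) (k + 1)) :
    Module.Finite Γ (cosyzygy M (i + 1)) ∧
      HasProjectiveDimensionLT (cosyzygy M (i + 1)) (k + 2) := by
  have hhull := isCogenerated_hull hsoc hM
  have hexact := shortExact_cosyzygy M i
  have := hhull.finite
  have : Projective (hull (cosyzygy M i)) := (IsProjective.iff_projective _).mp hhull.projective
  exact ⟨Module.Finite.of_surjective _ ((ModuleCat.epi_iff_surjective _).mp hexact.epi_g),
    hexact.hasProjectiveDimensionLT_X₃ (k + 1) hpd
      (hasProjectiveDimensionLT_of_ge (hull _) 1 _ (by omega))⟩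

theorem isCogenerated_cosyzygy (hpd : projDimLE n Γ ≤ subReg Γ)
    (hsoc : socleSubReg Γ ≤ subReg Γ) {i : ℕ} (hi : i ≤ n) :
    IsCogenerated Γ (cosyzygy (ModuleCat.of Γ Γ) i) := by
  have hcog {i : ℕ} (hi : i ≤ n) : Module.Finite Γ (cosyzygy (ModuleCat.of Γ Γ) i) ∧
      HasProjectiveDimensionLT (cosyzygy (ModuleCat.of Γ Γ) i) (i + 1) →
      IsCogenerated Γ (cosyzygy (ModuleCat.of Γ Γ) i) := fun ⟨_, h⟩ =>
    hpd (FGModuleCat.of Γ _) (pd_le_iff.mpr (hasProjectiveDimensionLT_of_ge _ (i + 1) _ (by omega)))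
  refine hcog hi ?_
  induction i with
  | zero =>
    exact ⟨inferInstanceAs (Module.Finite Γ Γ), projective_iff_hasProjectiveDimensionLT_one.mp
      ((IsProjective.iff_projective (R := Γ) Γ).mp inferInstance)⟩
  | succ i ih =>
    have hi' : i ≤ n := Nat.le_of_succ_le hi
    exact finite_and_hasProjectiveDimensionLT_cosyzygy_succ hsoc (hcog hi' (ih hi')) (ih hi').2

theorem succ_le_domdim_iff :
    ((n + 1 : ℕ) : ℕ∞) ≤ domdim Γ ↔ projDimLE n Γ ≤ subReg Γ ∧ socleSubReg Γ ≤ subReg Γ := by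
  rw [succ_le_domdim_iff_exists]
  constructor
  · rintro ⟨I, -, hI⟩
    exact ⟨projDimLE_le_subReg I hI,
      (isQF3_of_projective_zero I (hI 0 (Nat.zero_le n))).socleSubReg_le_subReg⟩
  · rintro ⟨hpd, hsoc⟩
    refine ⟨minimalResolution _, isMinimal_minimalResolution _, fun j hj => ?_⟩
    exact (isCogenerated_hull hsoc (isCogenerated_cosyzygy hpd hsoc hj)).projective

theorem socleProjDimLE_eq_socleSubReg (h : projDimLE n Γ = subReg Γ) :
    socleProjDimLE n Γ = socleSubReg Γ :=
  funext fun N => congrFun h (FGModuleCat.of Γ (socle Γ N))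

end Auslander

end ArtinAlg

theorem corollary4p4_general {Γ : Type u} [Ring Γ] [IsArtinianRing Γ] (n : ℕ) :
    ArtinAlg.IsAuslander n Γ ↔
      ArtinAlg.projDimLE n Γ = ArtinAlg.socleProjDimLE n Γ ∧
        ArtinAlg.socleProjDimLE n Γ = ArtinAlg.subReg Γ := by
  rw [ArtinAlg.IsAuslander, ArtinAlg.gldim_le_succ_iff, ArtinAlg.succ_le_domdim_iff]
  constructor
  · rintro ⟨hgl, hpd, hsoc⟩
    have hproj := le_antisymm hpd hgl
    have hsocle := (ArtinAlg.socleProjDimLE_eq_socleSubReg hproj).trans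
      (le_antisymm hsoc ArtinAlg.subReg_le_socleSubReg)
    exact ⟨hproj.trans hsocle.symm, hsocle⟩
  · rintro ⟨hproj, hsocle⟩
    have hproj' := hproj.trans hsocle
    have hsoc := (ArtinAlg.socleProjDimLE_eq_socleSubReg hproj').symm.trans hsocle
    exact ⟨hproj'.ge, hproj'.le, hsoc.le⟩

theorem corollary4p4 {R : Type*} {Γ : Type u} [CommRing R] [IsArtinianRing R] [Ring Γ]
    [Algebra R Γ] [Module.Finite R Γ] (n : ℕ) :
    ArtinAlg.IsAuslander n Γ ↔
      ArtinAlg.projDimLE n Γ = ArtinAlg.socleProjDimLE n Γ ∧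
        ArtinAlg.socleProjDimLE n Γ = ArtinAlg.subReg Γ := by
  have : IsArtinianRing Γ := isArtinian_of_tower R inferInstance
  exact corollary4p4_general n
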